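/- All graphs are finite, simple and connected. A signed graph $G_\sigma$ is a graph $G$ together with a map $\sigma : E(G) \to \{+1,-1\}$. Its Laplacian is $L(G_\sigma) = D - A_\sigma$, where $D$ is the diagonal matrix of vertex degrees and $A_\sigma$ is the signed adjacency matrix, with entry $\sigma(xy)$ at $(x,y)$ if $xy$ is an edge and $0$ otherwise; the Laplacian $L(G)$ of an ordinary graph is the case $\sigma \equiv +1$. The critical group $\mathcal{K}(G_\sigma)$ is the torsion subgroup of the cokernel of $L(G_\sigma)$ over $\mathbb{Z}$. For an integer $N \ge 2$, an $N$-colored Adinkra is a signed graph $\mathcal{A} = G_\sigma$ with each edge colored by one of $N$ colors such that: (1) $G$ is bipartite; (2) every vertex is incident to exactly one edge of each color; (3) for every pair of distinct colors, the graph restricted to the edges of these two colors is a disjoint union of $4$-cycles; (4) each such bi-colored $4$-cycle contains an odd number of negative edges. **Theorem.** Let $\mathcal{A}$ be an $N$-colored Adinkra on $v$ vertices, $N \ge 2$, with underlying graph $G$. Then $v$ is even, and if the rank over $\mathbb{F}_2$ of the Laplacian $L(G)$ is written as $v/2 - m$, then $m \ge 0$ and $$\mathcal{K}(\mathcal{A})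 \cong (\mathbb{Z}/2\mathbb{Z})^m \oplus \left(\mathbb{Z}/\tfrac{N^2-N}{2}\mathbb{Z}\right)^m \oplus \left(\mathbb{Z}/(N^2-N)\mathbb{Z}\right)^{v/2-m}.$$ -/

import Mathlib

/-- A signed graph: a simple graph with a sign `1` or `-1` on every edge. -/
structure SignedGraph (V : Type*) where
  /-- the underlying graph -/
  graph : SimpleGraph V
  /-- the signature -/
  sign : graph.EdgeLabeling ℤˣ

namespace SignedGraph

variable {V : Type*} (S : SignedGraph V)

/-- The graph formed by the negative edges. -/
def negGraph : SimpleGraph V := S.sign.labelGraph (-1)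

/-- The signed adjacency matrix: `1` at a positive edge, `-1` at a negative edge, `0` elsewhere. -/
def signedAdjMatrix [DecidableRel S.graph.Adj] : Matrix V V ℤ :=
  Matrix.of fun x y => if h : S.graph.Adj x y then ((S.sign.get x y h : ℤˣ) : ℤ) else 0

/-- The Laplacian of a signed graph: degree matrix minus signed adjacency matrix. -/
def laplacian [Fintype V] [DecidableEq V] [DecidableRel S.graph.Adj] : Matrix V V ℤ :=
  S.graph.degMatrix ℤ - S.signedAdjMatrix

/-- The critical group: the torsion part of the cokernel of the Laplacian over `ℤ`. -/
abbrev CriticalGroup [Fintype V] [DecidableEq V] [DecidableRel S.graph.Adj] :=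
  Submodule.torsion ℤ ((V → ℤ) ⧸ LinearMap.range S.laplacian.mulVecLin)

end SignedGraph

/-- The graph formed by the edges having color `i` or color `j`. -/
def SimpleGraph.EdgeLabeling.bicolorGraph {V K : Type*} {G : SimpleGraph V}
    (c : G.EdgeLabeling K) (i j : K) : SimpleGraph V :=
  c.labelGraph i ⊔ c.labelGraph j

/-- An `N`-colored Adinkra with vertex set `V`. -/
structure Adinkra (V : Type*) (N : ℕ) extends SignedGraph V where
  /-- the color of each edge -/
  color : graph.EdgeLabeling (Fin N)
  connected : graph.Connected
  bipartite : graph.IsBipartite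
  /-- every vertex is incident to exactly one edge of each color -/
  existsUnique_edge : ∀ (v : V) (i : Fin N),
    ∃! e : graph.edgeSet, v ∈ (e : Sym2 V) ∧ color e = i
  /-- the edges of two distinct colors form a disjoint union of 4-cycles -/
  bicolor_component : ∀ i j : Fin N, i ≠ j →
    ∀ C : (color.bicolorGraph i j).ConnectedComponent,
      Nonempty (C.toSimpleGraph ≃g SimpleGraph.cycleGraph 4)
  /-- each bi-colored 4-cycle contains an odd number of negative edges -/
  odd_negative : ∀ i j : Fin N, i ≠ j →
    ∀ (v : V) (p : (color.bicolorGraph i j).Walk v v), p.IsCycle → p.length = 4 →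
      Odd (p.edgeSet ∩ toSignedGraph.negGraph.edgeSet).ncard

/-- The 2-rank of the Laplacian of a graph: its rank over the field with two elements. -/
noncomputable def SimpleGraph.laplacianTwoRank {V : Type*} (G : SimpleGraph V)
    [Fintype V] [DecidableEq V] [DecidableRel G.Adj] : ℕ :=
  ((G.lapMatrix ℤ).map (Int.castRingHom (ZMod 2))).rank

/-!
Let `A` be the signed adjacency matrix. Its restrictions to the single colors are anticommuting
involutions, so they generate a Clifford algebra: `A * A = N`, and `T * A + A * T = 2` for each
color matrix `T`. Hence `L * (N + A) = N ^ 2 - N`, while the bipartition conjugates `L = N - A` to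
`N + A`. If `d i` are the diagonal entries of a Smith form of `L`, then `e i = (N ^ 2 - N) / d i`
are those of `N + A`, and the relation with `T`, read on the diagonal, gives `gcd (d i) (e i) ∣ 2`.
So at an odd prime each `d i` has valuation `0` or that of `N ^ 2 - N`, and the determinant
balances the two; at `2` the values next to these extremes also occur, and the number of odd `d i`
and of odd `e i` is the rank modulo `2`.
-/

theorem exists_equiv_comp_eq_of_map_univ_eq {α β K : Type*} [Fintype α] [Fintype β]
    {f : α → K} {g : β → K}
    (h : Finset.univ.val.map f = Finset.univ.val.map g) : ∃ e : α ≃ β, g ∘ e = f := by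
  classical
  have hfiber (k : K) : Nonempty ({i // f i = k} ≃ {j // g j = k}) := by
    refine ⟨Fintype.equivOfCardEq ?_⟩
    have hcount := congrArg (Multiset.count k) h
    simp only [Multiset.count_map, eq_comm (a := k)] at hcount
    rw [Fintype.card_subtype, Fintype.card_subtype]
    exact hcount
  let e k := (hfiber k).some
  refine ⟨(Equiv.sigmaFiberEquiv f).symm.trans
    ((Equiv.sigmaCongrRight e).trans (Equiv.sigmaFiberEquiv g)), funext fun i => ?_⟩
  exact (e (f i) ⟨i, rfl⟩).2

theorem nonempty_piAddEquiv_of_map_univ_eq {α β K : Type*} [Fintype α] [Fintype β]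
    {G : K → Type*} [∀ k, AddCommMonoid (G k)] {f : α → K} {g : β → K}
    (h : Finset.univ.val.map f = Finset.univ.val.map g) :
    Nonempty ((∀ i, G (f i)) ≃+ ∀ j, G (g j)) := by
  obtain ⟨e, rfl⟩ := exists_equiv_comp_eq_of_map_univ_eq h
  exact ⟨(LinearEquiv.piCongrLeft ℕ (fun j => G (g j)) e).toAddEquiv⟩

section PrimaryDecomposition

variable {k : ℕ}

theorem nonempty_zmodAddEquiv_pi_primeFactors {n : ℕ} (hk : k ≠ 0) (hn : n ∣ k) :
    Nonempty (ZMod n ≃+ ∀ p : k.primeFactors, ZMod ((p : ℕ) ^ n.factorization p)) := by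
  have hprod : ∏ p : k.primeFactors, (p : ℕ) ^ n.factorization p = n := by
    rw [Finset.prod_coe_sort k.primeFactors fun p => p ^ n.factorization p]
    conv_rhs => rw [← Nat.prod_factorization_pow_eq_self (ne_zero_of_dvd_ne_zero hk hn)]
    exact (Finsupp.prod_of_support_subset _ (Nat.primeFactors_mono hn hk) _ (by simp)).symm
  have hcoprime : Pairwise (Function.onFun Nat.Coprime
      fun p : k.primeFactors => (p : ℕ) ^ n.factorization p) := fun p q hpq =>
    Nat.coprime_pow_primes _ _ (Nat.prime_of_mem_primeFactors p.2)
      (Nat.prime_of_mem_primeFactors q.2) (Subtype.coe_ne_coe.2 hpq)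
  exact ⟨((ZMod.ringEquivCongr hprod.symm).trans (ZMod.prodEquivPi _ hcoprime)).toAddEquiv⟩

theorem nonempty_piZModAddEquiv_pi_primeFactors {α : Type*} {d : α → ℕ} (hk : k ≠ 0)
    (hd : ∀ i, d i ∣ k) :
    Nonempty ((∀ i, ZMod (d i)) ≃+
      ∀ p : k.primeFactors, ∀ i, ZMod ((p : ℕ) ^ (d i).factorization p)) := by
  let crt i := (nonempty_zmodAddEquiv_pi_primeFactors hk (hd i)).some
  exact ⟨(AddEquiv.piCongrRight crt).trans { Equiv.piComm _ with map_add' := fun _ _ => rfl }⟩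

theorem nonempty_piZModAddEquiv {α β : Type*} [Fintype α] [Fintype β] {d : α → ℕ}
    {e : β → ℕ} (hk : k ≠ 0) (hd : ∀ i, d i ∣ k) (he : ∀ j, e j ∣ k)
    (h : ∀ p, p.Prime → Finset.univ.val.map (fun i => (d i).factorization p) =
      Finset.univ.val.map fun j => (e j).factorization p) :
    Nonempty ((∀ i, ZMod (d i)) ≃+ ∀ j, ZMod (e j)) := by
  obtain ⟨φ⟩ := nonempty_piZModAddEquiv_pi_primeFactors hk hd
  obtain ⟨ψ⟩ := nonempty_piZModAddEquiv_pi_primeFactors hk he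
  let primary (p : k.primeFactors) := (nonempty_piAddEquiv_of_map_univ_eq
    (G := fun a => ZMod ((p : ℕ) ^ a)) (h p (Nat.prime_of_mem_primeFactors p.2))).some
  exact ⟨(φ.trans (AddEquiv.piCongrRight primary)).trans ψ.symm⟩

end PrimaryDecomposition

section BalancedMultisets

variable {s : Multiset ℕ}

theorem eq_replicate_add_replicate {a b n : ℕ} (hab : ∀ x ∈ s, x = a ∨ x = b)
    (hcard : s.card = 2 * n) (hsum : s.sum = n * (a + b)) :
    s = Multiset.replicate n a + Multiset.replicate n b := by
  have hs : s = Multiset.replicate (s.count a) a + s.filter (a ≠ ·) := by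
    rw [← Multiset.filter_eq, Multiset.filter_add_not]
  have hb : s.filter (a ≠ ·) = Multiset.replicate (s.filter (a ≠ ·)).card b :=
    Multiset.eq_replicate_card.2 fun x hx =>
      (hab x (Multiset.mem_of_mem_filter hx)).resolve_left (Multiset.of_mem_filter hx).symm
  rw [hb] at hs
  generalize s.count a = i at hs
  generalize (s.filter (a ≠ ·)).card = j at hs
  subst hs
  simp only [Multiset.card_add, Multiset.card_replicate, Multiset.sum_add,
    Multiset.sum_replicate, smul_eq_mul] at hcard hsum
  obtain rfl | hne := eq_or_ne a b
  · rw [← Multiset.replicate_add, ← Multiset.replicate_add, hcard, two_mul]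
  · have hprod : ((i : ℤ) - n) * (a - b) = 0 := by
      zify at hcard hsum
      linear_combination hsum - (b : ℤ) * hcard
    have hi : i = n := by
      rcases mul_eq_zero.1 hprod with h | h
      · omega
      · exact absurd h (by omega)
    obtain rfl : j = n := by omega
    rw [hi]

theorem eq_replicate_zero_one_pred_self {μ r m : ℕ} (hμ : μ ≠ 0)
    (hs : ∀ x ∈ s, x = 0 ∨ x = 1 ∨ x + 1 = μ ∨ x = μ) (hzero : s.count 0 = r)
    (htop : s.count μ = r) (hcard : s.card = 2 * (m + r)) (hsum : s.sum = (m + r) * μ) :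
    s = Multiset.replicate r 0 + Multiset.replicate r μ +
      (Multiset.replicate m 1 + Multiset.replicate m (μ - 1)) := by
  have hle : Multiset.replicate r 0 + Multiset.replicate r μ ≤ s := by
    refine Multiset.le_iff_count.2 fun x => ?_
    simp only [Multiset.count_add, Multiset.count_replicate]
    split_ifs <;> grind
  obtain ⟨t, rfl⟩ := Multiset.le_iff_exists_add.1 hle
  congr 1
  simp only [Multiset.count_add, Multiset.count_replicate_self, Multiset.count_replicate, hμ,
    hμ.symm, if_false, add_zero, zero_add, Nat.add_eq_left, Multiset.count_eq_zero] at hzero htop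
  simp only [Multiset.card_add, Multiset.card_replicate, Multiset.sum_add,
    Multiset.sum_replicate, smul_eq_mul] at hcard hsum
  refine eq_replicate_add_replicate (fun x hx => ?_) (by omega) ?_
  · have h0 : x ≠ 0 := fun h => hzero (h ▸ hx)
    have h1 : x ≠ μ := fun h => htop (h ▸ hx)
    have := hs x (Multiset.mem_add.2 (Or.inr hx))
    omega
  · have : 1 + (μ - 1) = μ := by omega
    rw [this]; linarith

end BalancedMultisets

section ComplementaryDivisors

theorem min_factorization_le_of_gcd_dvd {a b c : ℕ} (ha : a ≠ 0) (hb : b ≠ 0) (hc : c ≠ 0)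
    (h : a.gcd b ∣ c) (p : ℕ) :
    min (a.factorization p) (b.factorization p) ≤ c.factorization p := by
  have hle := (Nat.factorization_le_iff_dvd (Nat.gcd_ne_zero_left ha) hc).2 h p
  rwa [Nat.factorization_gcd ha hb, Finsupp.inf_apply] at hle

theorem sum_factorization_of_prod_eq_pow {ι : Type*} [Fintype ι] {d : ι → ℕ} {M n : ℕ}
    (hd : ∀ i, d i ≠ 0) (hprod : ∏ i, d i = M ^ n) (p : ℕ) :
    ∑ i, (d i).factorization p = n * M.factorization p := by
  have h := congrArg (fun k => k.factorization p) hprod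
  simpa [Nat.factorization_prod fun i _ => hd i, Finsupp.finsetSum_apply] using h

variable {ι : Type*} [Fintype ι] {d e : ι → ℕ} {M n r m : ℕ}

theorem map_factorization_of_ne_two {p : ℕ} (hp2 : p ≠ 2) (hM : M ≠ 0)
    (hcard : Fintype.card ι = 2 * n) (hde : ∀ i, d i * e i = M)
    (hgcd : ∀ i, (d i).gcd (e i) ∣ 2) (hprod : ∏ i, d i = M ^ n) :
    Finset.univ.val.map (fun i => (d i).factorization p) =
      Multiset.replicate n 0 + Multiset.replicate n (M.factorization p) := by
  have hd i : d i ≠ 0 := left_ne_zero_of_mul (hde i ▸ hM)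
  have he i : e i ≠ 0 := right_ne_zero_of_mul (hde i ▸ hM)
  refine eq_replicate_add_replicate ?_ (by simpa using hcard) ?_
  · simp only [Multiset.mem_map, Finset.mem_val, Finset.mem_univ, true_and, forall_exists_index,
      forall_apply_eq_imp_iff]
    intro i
    have hmin := min_factorization_le_of_gcd_dvd (hd i) (he i) two_ne_zero (hgcd i) p
    rw [Nat.prime_two.factorization, Finsupp.single_eq_of_ne hp2] at hmin
    have hadd := congrArg (fun k => k.factorization p) (hde i)
    simp only [Nat.factorization_mul (hd i) (he i), Finsupp.add_apply] at hadd
    omega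
  · rw [zero_add, ← sum_factorization_of_prod_eq_pow hd hprod, Finset.sum_map_val]

theorem factorization_two_eq_zero_iff {a : ℕ} (ha : a ≠ 0) : a.factorization 2 = 0 ↔ ¬ 2 ∣ a := by
  simp [Nat.factorization_eq_zero_iff, Nat.prime_two, ha]

theorem map_factorization_two (hM : M ≠ 0) (hM2 : 2 ∣ M)
    (hcard : Fintype.card ι = 2 * (m + r)) (hde : ∀ i, d i * e i = M)
    (hgcd : ∀ i, (d i).gcd (e i) ∣ 2) (hprod : ∏ i, d i = M ^ (m + r))
    (hdr : Fintype.card {i // ¬ 2 ∣ d i} = r) (her : Fintype.card {i // ¬ 2 ∣ e i} = r) :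
    Finset.univ.val.map (fun i => (d i).factorization 2) =
      Multiset.replicate r 0 + Multiset.replicate r (M.factorization 2) +
        (Multiset.replicate m 1 + Multiset.replicate m (M.factorization 2 - 1)) := by
  have hd i : d i ≠ 0 := left_ne_zero_of_mul (hde i ▸ hM)
  have he i : e i ≠ 0 := right_ne_zero_of_mul (hde i ▸ hM)
  have hadd i : (d i).factorization 2 + (e i).factorization 2 = M.factorization 2 := by
    rw [← hde i, Nat.factorization_mul (hd i) (he i), Finsupp.add_apply]
  refine eq_replicate_zero_one_pred_self (Nat.prime_two.factorization_pos_of_dvd hM hM2).ne'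
    ?_ ?_ ?_ (by simpa using hcard) ?_
  · simp only [Multiset.mem_map, Finset.mem_val, Finset.mem_univ, true_and, forall_exists_index,
      forall_apply_eq_imp_iff]
    intro i
    have hmin := min_factorization_le_of_gcd_dvd (hd i) (he i) two_ne_zero (hgcd i) 2
    rw [Nat.prime_two.factorization_self] at hmin
    specialize hadd i
    omega
  · rw [Multiset.count_map, ← hdr, Fintype.card_subtype]
    simp_rw [← factorization_two_eq_zero_iff (hd _), eq_comm]
    rfl
  · have hiff i : M.factorization 2 = (d i).factorization 2 ↔ ¬ 2 ∣ e i := by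
      rw [← factorization_two_eq_zero_iff (he i), ← hadd i]
      omega
    simp_rw [Multiset.count_map, ← her, Fintype.card_subtype, hiff]
    rfl
  · rw [← sum_factorization_of_prod_eq_pow hd hprod, Finset.sum_map_val]

/-- The orders of the cyclic factors `ℤ/2`, `ℤ/(M/2)` and `ℤ/M`, padded by `r` trivial factors to
a family of `2 * (m + r)` divisors of `M`. -/
def standardOrders (m r M : ℕ) : Fin m ⊕ Fin m ⊕ Fin r ⊕ Fin r → ℕ :=
  Sum.elim (fun _ => 2) (Sum.elim (fun _ => M / 2) (Sum.elim (fun _ => M) fun _ => 1))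

theorem map_comp_standardOrders {K : Type*} (f : ℕ → K) :
    Finset.univ.val.map (fun j => f (standardOrders m r M j)) =
      Multiset.replicate m (f 2) + (Multiset.replicate m (f (M / 2)) +
        (Multiset.replicate r (f M) + Multiset.replicate r (f 1))) := by
  simp [standardOrders, ← Finset.univ_disjSum_univ, Multiset.map_disjSum]

theorem standardOrders_dvd (hM2 : 2 ∣ M) : ∀ j, standardOrders m r M j ∣ M := by
  simpa [standardOrders] using ⟨fun _ => hM2, fun _ => Nat.div_dvd_of_dvd hM2⟩

/-- Dropping the trivial factors of the product of cyclic groups of orders `standardOrders`. -/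
def piStandardOrdersAddEquiv :
    (∀ j, ZMod (standardOrders m r M j)) ≃+
      (Fin m → ZMod 2) × (Fin m → ZMod (M / 2)) × (Fin r → ZMod M) where
  toFun x := (fun i => x (.inl i), fun i => x (.inr (.inl i)), fun i => x (.inr (.inr (.inl i))))
  invFun y := Sum.rec y.1 (Sum.rec y.2.1 (Sum.rec y.2.2 fun _ => 0))
  left_inv x := by
    ext (_ | _ | _ | _)
    · rfl
    · rfl
    · rfl
    · exact Subsingleton.elim (α := ZMod 1) _ _
  right_inv _ := rfl
  map_add' _ _ := rfl

theorem nonempty_piZModAddEquiv_of_mul_eq (hM : M ≠ 0) (hM2 : 2 ∣ M)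
    (hcard : Fintype.card ι = 2 * (m + r)) (hde : ∀ i, d i * e i = M)
    (hgcd : ∀ i, (d i).gcd (e i) ∣ 2) (hprod : ∏ i, d i = M ^ (m + r))
    (hdr : Fintype.card {i // ¬ 2 ∣ d i} = r) (her : Fintype.card {i // ¬ 2 ∣ e i} = r) :
    Nonempty ((∀ i, ZMod (d i)) ≃+
      (Fin m → ZMod 2) × (Fin m → ZMod (M / 2)) × (Fin r → ZMod M)) := by
  have hprimary (p : ℕ) (hp : p.Prime) :
      Finset.univ.val.map (fun i => (d i).factorization p) =
        Finset.univ.val.map fun j => (standardOrders m r M j).factorization p := by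
    rw [map_comp_standardOrders fun k => k.factorization p, Nat.factorization_one,
      Nat.factorization_div hM2, Finsupp.tsub_apply, Finsupp.zero_apply,
      Nat.prime_two.factorization]
    obtain rfl | hp2 := eq_or_ne p 2
    · rw [map_factorization_two hM hM2 hcard hde hgcd hprod hdr her, Finsupp.single_eq_same]
      abel
    · rw [map_factorization_of_ne_two hp2 hM hcard hde hgcd hprod,
        Finsupp.single_eq_of_ne hp2, Nat.sub_zero, Multiset.replicate_add, Multiset.replicate_add]
      abel
  obtain ⟨φ⟩ := nonempty_piZModAddEquiv hM (fun i => Dvd.intro _ (hde i))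
    (standardOrders_dvd hM2) hprimary
  exact ⟨φ.trans piStandardOrdersAddEquiv⟩

end ComplementaryDivisors

section Cokernel

variable {ι : Type*} [Fintype ι] [DecidableEq ι]

theorem matrix_det_natCast {R : Type*} [CommRing R] (k : ℕ) :
    (k : Matrix ι ι R).det = (k : R) ^ Fintype.card ι := by
  rw [← Matrix.diagonal_natCast, Matrix.det_diagonal, Finset.prod_const, Finset.card_univ]

theorem exists_units_mul_mul_eq_diagonal_int {L : Matrix ι ι ℤ} (hL : L.det ≠ 0) :
    ∃ (P Q : (Matrix ι ι ℤ)ˣ) (d : ι → ℤ), P * L * Q = Matrix.diagonal d ∧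
      Nonempty (((ι → ℤ) ⧸ LinearMap.range L.mulVecLin) ≃+ ∀ i, ZMod (d i).natAbs) := by
  let eL := LinearEquiv.ofInjective L.mulVecLin (Matrix.mulVec_injective_of_det_ne_zero hL)
  let b := Pi.basisFun ℤ ι
  have hrank : Module.finrank ℤ (LinearMap.range L.mulVecLin) = Module.finrank ℤ (ι → ℤ) :=
    eL.finrank_eq.symm
  let bTop := Submodule.smithNormalFormTopBasis b hrank
  let bBot := (Submodule.smithNormalFormBotBasis b hrank).map eL.symm
  let d := Submodule.smithNormalFormCoeffs b hrank
  have happly (j : ι) : L.mulVecLin (bBot j) = d j • bTop j := by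
    rw [← Submodule.smithNormalFormBotBasis_def b hrank j, Module.Basis.map_apply]
    exact congrArg Subtype.val (eL.apply_symm_apply _)
  have hdiagonal : LinearMap.toMatrix bBot bTop L.mulVecLin = Matrix.diagonal d := by
    ext i j
    rw [LinearMap.toMatrix_apply, happly, map_smul, Module.Basis.repr_self, Finsupp.smul_single,
      smul_eq_mul, mul_one, Finsupp.single_apply, Matrix.diagonal_apply]
    split_ifs with h1 h2 <;> simp_all
  let change (c c' : Module.Basis ι ℤ (ι → ℤ)) : (Matrix ι ι ℤ)ˣ :=
    ⟨c.toMatrix c', c'.toMatrix c, c.toMatrix_mul_toMatrix_flip c',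
      c'.toMatrix_mul_toMatrix_flip c⟩
  refine ⟨change bTop b, change b bBot, d, ?_, ⟨Submodule.quotientEquivPiZMod _ b hrank⟩⟩
  have hL' : LinearMap.toMatrix b b L.mulVecLin = L := LinearMap.toMatrix'_toLin' L
  rw [← hdiagonal,
    ← basis_toMatrix_mul_linearMap_toMatrix_mul_basis_toMatrix bBot b bTop b L.mulVecLin, hL']

theorem exists_units_mul_mul_eq_diagonal_nat {L : Matrix ι ι ℤ} (hL : L.det ≠ 0) :
    ∃ (P Q : (Matrix ι ι ℤ)ˣ) (d : ι → ℕ), P * L * Q = Matrix.diagonal (fun i => (d i : ℤ)) ∧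
      Nonempty (((ι → ℤ) ⧸ LinearMap.range L.mulVecLin) ≃+ ∀ i, ZMod (d i)) := by
  obtain ⟨P, Q, d, hd, hcoker⟩ := exists_units_mul_mul_eq_diagonal_int hL
  choose u hu using fun i => (Int.associated_natAbs (d i))
  let U := Units.map (Matrix.diagonalRingHom ι ℤ).toMonoidHom (MulEquiv.piUnits.symm u)
  refine ⟨U * P, Q, fun i => (d i).natAbs, ?_, hcoker⟩
  rw [Units.val_mul, mul_assoc, mul_assoc, ← mul_assoc _ L, hd]
  change Matrix.diagonal (fun i => (u i : ℤ)) * _ = _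
  simp only [Matrix.diagonal_mul_diagonal, ← hu, mul_comm]

theorem exists_eq_diagonal_of_diagonal_mul_eq_natCast {d : ι → ℕ} {E : Matrix ι ι ℤ} {M : ℕ}
    (hM : M ≠ 0) (h : Matrix.diagonal (fun i => (d i : ℤ)) * E = M) :
    ∃ e : ι → ℕ, E = Matrix.diagonal (fun i => (e i : ℤ)) ∧ ∀ i, d i * e i = M := by
  have hentry i j : (d i : ℤ) * E i j = if i = j then (M : ℤ) else 0 := by
    rw [← Matrix.diagonal_mul (fun i => (d i : ℤ)), h, ← Matrix.diagonal_natCast,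
      Matrix.diagonal_apply]
  have hself i : (d i : ℤ) * E i i = M := by rw [hentry, if_pos rfl]
  have hd i : 0 < (d i : ℤ) := by
    have : (d i : ℤ) ≠ 0 := left_ne_zero_of_mul (hself i ▸ Nat.cast_ne_zero.2 hM)
    omega
  have hE i : 0 ≤ E i i := nonneg_of_mul_nonneg_right (hself i ▸ Int.natCast_nonneg M) (hd i)
  refine ⟨fun i => (E i i).toNat, ?_, fun i => ?_⟩
  · ext i j
    obtain rfl | hij := eq_or_ne i j
    · simp [hE]
    · rw [Matrix.diagonal_apply_ne _ hij]
      exact (mul_eq_zero.1 ((hentry i j).trans (if_neg hij))).resolve_left (hd i).ne'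
  · zify
    rw [Int.toNat_of_nonneg (hE i), hself]

theorem rank_map_units_mul_mul {R K : Type*} [CommRing R] [Field K] (f : R →+* K)
    (P Q : (Matrix ι ι R)ˣ) (L : Matrix ι ι R) :
    ((P * L * Q : Matrix ι ι R).map f).rank = (L.map f).rank := by
  have hunit (U : (Matrix ι ι R)ˣ) : IsUnit ((U : Matrix ι ι R).map f).det :=
    (Matrix.isUnit_iff_isUnit_det _).1 (U.isUnit.map f.mapMatrix)
  rw [Matrix.map_mul, Matrix.map_mul, Matrix.rank_mul_eq_left_of_isUnit_det _ _ (hunit Q),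
    Matrix.rank_mul_eq_right_of_isUnit_det _ _ (hunit P)]

theorem rank_map_diagonal_natCast {p : ℕ} [Fact p.Prime] (d : ι → ℕ) :
    ((Matrix.diagonal fun i => (d i : ℤ)).map (Int.castRingHom (ZMod p))).rank =
      Fintype.card {i // ¬ p ∣ d i} := by
  classical
  rw [Matrix.diagonal_map (map_zero _), Matrix.rank_diagonal]
  simp [ZMod.natCast_eq_zero_iff]

theorem rank_map_eq_of_isConj {R K : Type*} [CommRing R] [Field K] (f : R →+* K)
    {L L' : Matrix ι ι R} (h : IsConj L L') : (L.map f).rank = (L'.map f).rank := by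
  obtain ⟨J, hJ⟩ := h
  rw [← rank_map_units_mul_mul f J J⁻¹, hJ.eq, Units.mul_inv_cancel_right]

theorem exists_units_mul_mul_eq_diagonal_of_mul_eq_natCast {L L' X Y : Matrix ι ι ℤ} {M k : ℕ}
    (hM : M ≠ 0) (hLL' : L * L' = M) (hXY : X * L + L' * Y = k) :
    ∃ (P Q : (Matrix ι ι ℤ)ˣ) (d e : ι → ℕ), P * L * Q = Matrix.diagonal (fun i => (d i : ℤ)) ∧
      Q⁻¹.val * L' * P⁻¹.val = Matrix.diagonal (fun i => (e i : ℤ)) ∧ (∀ i, d i * e i = M) ∧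
      (∀ i, (d i).gcd (e i) ∣ k) ∧
      Nonempty (((ι → ℤ) ⧸ LinearMap.range L.mulVecLin) ≃+ ∀ i, ZMod (d i)) := by
  have hdet : L.det ≠ 0 := by
    refine left_ne_zero_of_mul (b := L'.det) ?_
    rw [← Matrix.det_mul, hLL', matrix_det_natCast]
    exact pow_ne_zero _ (Nat.cast_ne_zero.2 hM)
  obtain ⟨P, Q, d, hd, hcoker⟩ := exists_units_mul_mul_eq_diagonal_nat hdet
  have hprod : Matrix.diagonal (fun i => (d i : ℤ)) * (Q⁻¹.val * L' * P⁻¹.val) = M := by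
    calc _ = P.val * (L * L') * P⁻¹.val := by
          simp only [← hd, mul_assoc, Units.mul_inv_cancel_left]
      _ = M := by rw [hLL', ← Nat.cast_commute, mul_assoc, Units.mul_inv, mul_one]
  obtain ⟨e, he, hde⟩ := exists_eq_diagonal_of_diagonal_mul_eq_natCast hM hprod
  refine ⟨P, Q, d, e, hd, he, hde, fun i => ?_, hcoker⟩
  have hsum : Q⁻¹.val * X * P⁻¹.val * Matrix.diagonal (fun i => (d i : ℤ)) +
      Matrix.diagonal (fun i => (e i : ℤ)) * (P.val * Y * Q.val) = k := by
    calc _ = Q⁻¹.val * (X * L + L' * Y) * Q.val := by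
          simp only [← hd, ← he, mul_assoc, Units.inv_mul_cancel_left, mul_add, add_mul]
      _ = k := by rw [hXY, ← Nat.cast_commute, mul_assoc, Units.inv_mul, mul_one]
  have hentry := congrFun₂ hsum i i
  rw [Matrix.add_apply, Matrix.mul_diagonal, Matrix.diagonal_mul, ← Matrix.diagonal_natCast,
    Matrix.diagonal_apply_eq] at hentry
  rw [← Int.natCast_dvd_natCast, ← hentry]
  exact dvd_add ((Int.natCast_dvd_natCast.2 (Nat.gcd_dvd_left ..)).mul_left _)
    ((Int.natCast_dvd_natCast.2 (Nat.gcd_dvd_right ..)).mul_right _)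

theorem natAbs_det_eq_pow {L L' : Matrix ι ι ℤ} {M n : ℕ} (hcard : Fintype.card ι = 2 * n)
    (hLL' : L * L' = M) (hconj : IsConj L L') : L.det.natAbs = M ^ n := by
  have hdet : L.det = L'.det := isConj_iff_eq.1 (Matrix.detMonoidHom.map_isConj hconj)
  have hsq : L.det * L.det = (M : ℤ) ^ (2 * n) := by
    calc L.det * L.det = (L * L').det := by rw [Matrix.det_mul, ← hdet]
      _ = (M : ℤ) ^ (2 * n) := by rw [hLL', matrix_det_natCast, hcard]
  refine Nat.mul_self_inj.1 ?_
  rw [← Int.natAbs_mul, hsq, Int.natAbs_pow, Int.natAbs_natCast]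
  ring

theorem exists_complementary_orders {L L' X Y : Matrix ι ι ℤ} {M n k : ℕ} (hM : M ≠ 0)
    (hcard : Fintype.card ι = 2 * n) (hLL' : L * L' = M) (hXY : X * L + L' * Y = k)
    (hconj : IsConj L L') :
    ∃ d e : ι → ℕ, (∀ i, d i * e i = M) ∧ (∀ i, (d i).gcd (e i) ∣ k) ∧ ∏ i, d i = M ^ n ∧
      (∀ p [Fact p.Prime],
        Fintype.card {i // ¬ p ∣ d i} = (L.map (Int.castRingHom (ZMod p))).rank ∧
        Fintype.card {i // ¬ p ∣ e i} = (L.map (Int.castRingHom (ZMod p))).rank) ∧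
      Nonempty (((ι → ℤ) ⧸ LinearMap.range L.mulVecLin) ≃+ ∀ i, ZMod (d i)) := by
  obtain ⟨P, Q, d, e, hd, he, hde, hgcd, hcoker⟩ :=
    exists_units_mul_mul_eq_diagonal_of_mul_eq_natCast hM hLL' hXY
  refine ⟨d, e, hde, hgcd, ?_, fun p _ => ⟨?_, ?_⟩, hcoker⟩
  · have hunit (U : (Matrix ι ι ℤ)ˣ) : U.val.det.natAbs = 1 :=
      Int.isUnit_iff_natAbs_eq.1 ((Matrix.isUnit_iff_isUnit_det _).1 U.isUnit)
    have hdet := congrArg (fun A => (Matrix.det A).natAbs) hd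
    simp only [Matrix.det_mul, Matrix.det_diagonal, Int.natAbs_mul, hunit, one_mul, mul_one,
      natAbs_det_eq_pow hcard hLL' hconj, ← Nat.cast_prod, Int.natAbs_natCast] at hdet
    exact hdet.symm
  · rw [← rank_map_diagonal_natCast, ← hd, rank_map_units_mul_mul]
  · rw [← rank_map_diagonal_natCast, ← he, rank_map_units_mul_mul,
      rank_map_eq_of_isConj (Int.castRingHom (ZMod p)) hconj]

theorem rank_map_zmod_le {p : ℕ} [Fact p.Prime] {L L' : Matrix ι ι ℤ} {M n : ℕ}
    (hpM : p ∣ M) (hcard : Fintype.card ι = 2 * n) (hLL' : L * L' = M) (hconj : IsConj L L') :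
    (L.map (Int.castRingHom (ZMod p))).rank ≤ n := by
  have hzero : L.map (Int.castRingHom (ZMod p)) * L'.map (Int.castRingHom (ZMod p)) = 0 := by
    rw [← Matrix.map_mul, hLL', ← Matrix.diagonal_natCast, Matrix.diagonal_map (map_zero _)]
    simp [(ZMod.natCast_eq_zero_iff M p).2 hpM]
  have hle := Matrix.rank_add_rank_le_card_of_mul_eq_zero hzero
  rw [← rank_map_eq_of_isConj _ hconj, hcard] at hle
  omega

theorem nonempty_coker_addEquiv {L L' X Y : Matrix ι ι ℤ} {M m r : ℕ} (hM : M ≠ 0)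
    (hM2 : 2 ∣ M) (hcard : Fintype.card ι = 2 * (m + r)) (hLL' : L * L' = M)
    (hXY : X * L + L' * Y = 2) (hconj : IsConj L L')
    (hr : (L.map (Int.castRingHom (ZMod 2))).rank = r) :
    Nonempty (((ι → ℤ) ⧸ LinearMap.range L.mulVecLin) ≃+
      (Fin m → ZMod 2) × (Fin m → ZMod (M / 2)) × (Fin r → ZMod M)) := by
  obtain ⟨d, e, hde, hgcd, hprod, hrank, ⟨φ⟩⟩ :=
    exists_complementary_orders hM hcard hLL' hXY hconj
  obtain ⟨ψ⟩ := nonempty_piZModAddEquiv_of_mul_eq hM hM2 hcard hde hgcd hprod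
    ((hrank 2).1.trans hr) ((hrank 2).2.trans hr)
  exact ⟨φ.trans ψ⟩

theorem torsion_coker_eq_top {R : Type*} [CommRing R] {L L' : Matrix ι ι R} {M : ℕ}
    (hM : (M : R) ∈ nonZeroDivisors R) (hLL' : L * L' = M) :
    Submodule.torsion R ((ι → R) ⧸ LinearMap.range L.mulVecLin) = ⊤ := by
  refine eq_top_iff.2 fun x _ => (Submodule.mem_torsion_iff x).2 ⟨⟨M, hM⟩, ?_⟩
  obtain ⟨y, rfl⟩ := Submodule.Quotient.mk_surjective _ x
  refine (Submodule.Quotient.mk_eq_zero _).2 ⟨L'.mulVec y, ?_⟩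
  rw [Matrix.mulVecLin_apply, Matrix.mulVec_mulVec, hLL', Matrix.natCast_mulVec]

end Cokernel

namespace SignedGraph

variable {V : Type*} (S : SignedGraph V) [DecidableRel S.graph.Adj]

theorem signedAdjMatrix_of_adj {x y : V} (h : S.graph.Adj x y) :
    S.signedAdjMatrix x y = ((S.sign ⟨s(x, y), h⟩ : ℤˣ) : ℤ) := by
  simp [signedAdjMatrix, h, SimpleGraph.EdgeLabeling.get_eq]

theorem signedAdjMatrix_of_not_adj {x y : V} (h : ¬ S.graph.Adj x y) :
    S.signedAdjMatrix x y = 0 := by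
  simp [signedAdjMatrix, h]

theorem signedAdjMatrix_comm (x y : V) : S.signedAdjMatrix x y = S.signedAdjMatrix y x := by
  by_cases h : S.graph.Adj x y
  · rw [S.signedAdjMatrix_of_adj h, S.signedAdjMatrix_of_adj h.symm]
    congr 3
    exact Sym2.eq_swap
  · rw [S.signedAdjMatrix_of_not_adj h, S.signedAdjMatrix_of_not_adj fun h' => h h'.symm]

theorem signedAdjMatrix_mul_self_of_adj {x y : V} (h : S.graph.Adj x y) :
    S.signedAdjMatrix x y * S.signedAdjMatrix x y = 1 := by
  rw [S.signedAdjMatrix_of_adj h, ← Units.val_mul, Int.units_mul_self, Units.val_one]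

theorem signedAdjMatrix_eq_neg_one_of_negGraph_adj {x y : V} (h : S.negGraph.Adj x y) :
    S.signedAdjMatrix x y = -1 := by
  obtain ⟨hadj, hsign⟩ := (SimpleGraph.EdgeLabeling.labelGraph_adj x y).1 h
  rw [S.signedAdjMatrix_of_adj hadj, hsign, Units.val_neg, Units.val_one]

theorem signedAdjMatrix_eq_one_of_not_negGraph_adj {x y : V} (h : S.graph.Adj x y)
    (hneg : ¬ S.negGraph.Adj x y) : S.signedAdjMatrix x y = 1 := by
  rw [S.signedAdjMatrix_of_adj h, (Int.units_eq_one_or _).resolve_right fun hsign =>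
    hneg ((SimpleGraph.EdgeLabeling.labelGraph_adj x y).2 ⟨h, hsign⟩), Units.val_one]

theorem prod_darts_signedAdjMatrix {H : SimpleGraph V} (hH : H ≤ S.graph) {u v : V}
    {p : H.Walk u v} (hp : p.IsTrail) :
    (p.darts.map fun d => S.signedAdjMatrix d.fst d.snd).prod =
      (-1) ^ (p.edgeSet ∩ S.negGraph.edgeSet).ncard := by
  induction p with
  | nil => simp
  | @cons u v w h p ih =>
    obtain ⟨hp, hnotMem⟩ := (SimpleGraph.Walk.isTrail_cons h p).1 hp
    rw [SimpleGraph.Walk.darts_cons, List.map_cons, List.prod_cons, ih hp,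
      SimpleGraph.Walk.edgeSet_cons]
    by_cases hneg : S.negGraph.Adj u v
    · have hnotMem' : s(u, v) ∉ p.edgeSet ∩ S.negGraph.edgeSet := fun hmem => hnotMem hmem.1
      have hfinite : (p.edgeSet ∩ S.negGraph.edgeSet).Finite :=
        p.edges.finite_toSet.inter_of_left _
      rw [Set.insert_inter_of_mem (S.negGraph.mem_edgeSet.2 hneg),
        Set.ncard_insert_of_notMem hnotMem' hfinite, pow_succ',
        S.signedAdjMatrix_eq_neg_one_of_negGraph_adj hneg]
    · rw [Set.insert_inter_of_notMem (mt S.negGraph.mem_edgeSet.1 hneg),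
        S.signedAdjMatrix_eq_one_of_not_negGraph_adj (hH h) hneg, one_mul]

theorem laplacian_map_zmod_two [Fintype V] [DecidableEq V] :
    S.laplacian.map (Int.castRingHom (ZMod 2)) =
      (S.graph.lapMatrix ℤ).map (Int.castRingHom (ZMod 2)) := by
  ext x y
  simp only [laplacian, SimpleGraph.lapMatrix, Matrix.map_apply, Matrix.sub_apply, map_sub]
  congr 1
  by_cases h : S.graph.Adj x y
  · rw [S.signedAdjMatrix_of_adj h, SimpleGraph.adjMatrix_apply, if_pos h]
    rcases Int.units_eq_one_or (S.sign ⟨s(x, y), h⟩) with hsign | hsign <;> rw [hsign] <;> decide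
  · rw [S.signedAdjMatrix_of_not_adj h, SimpleGraph.adjMatrix_apply, if_neg h]

theorem exists_semiconjBy_signedAdjMatrix_neg [Fintype V] [DecidableEq V]
    (hS : S.graph.IsBipartite) :
    ∃ J : (Matrix V V ℤ)ˣ, SemiconjBy ↑J S.signedAdjMatrix (-S.signedAdjMatrix) := by
  obtain ⟨c⟩ := hS
  let u (x : V) : ℤˣ := if c x = 0 then 1 else -1
  refine ⟨Units.map (Matrix.diagonalRingHom V ℤ).toMonoidHom (MulEquiv.piUnits.symm u), ?_⟩
  change Matrix.diagonal (fun x => (u x : ℤ)) * _ = _ * Matrix.diagonal (fun x => (u x : ℤ))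
  ext x y
  rw [Matrix.diagonal_mul, Matrix.mul_diagonal, Matrix.neg_apply]
  by_cases h : S.graph.Adj x y
  · have hu : u x = -u y := by
      have hc := c.valid h
      simp only [u]
      split_ifs <;> first | rfl | omega
    rw [hu, Units.val_neg]
    ring
  · rw [S.signedAdjMatrix_of_not_adj h]
    ring

end SignedGraph

theorem cycleGraph_four_eq_of_adj : ∀ x a b c d : Fin 4,
    (SimpleGraph.cycleGraph 4).Adj x a → (SimpleGraph.cycleGraph 4).Adj x b → a ≠ b →
    (SimpleGraph.cycleGraph 4).Adj a c → c ≠ x → (SimpleGraph.cycleGraph 4).Adj b d → d ≠ x →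
    c = d := by
  simp only [SimpleGraph.cycleGraph_adj']
  decide

namespace Adinkra

variable {V : Type*} {N : ℕ} (A : Adinkra V N)

theorem existsUnique_labelGraph_adj (i : Fin N) (x : V) :
    ∃! y, (A.color.labelGraph i).Adj x y := by
  obtain ⟨⟨e, he⟩, ⟨hx, hcolor⟩, huniq⟩ := A.existsUnique_edge x i
  obtain ⟨y, rfl⟩ := Sym2.mem_iff_exists.1 hx
  refine ⟨y, (SimpleGraph.EdgeLabeling.labelGraph_adj x y).2 ⟨he, hcolor⟩, fun z hz => ?_⟩
  obtain ⟨hadj, hz⟩ := (SimpleGraph.EdgeLabeling.labelGraph_adj x z).1 hz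
  exact Sym2.congr_right.1
    (congrArg Subtype.val (huniq ⟨s(x, z), hadj⟩ ⟨Sym2.mem_mk_left x z, hz⟩))

theorem even_card [Fintype V] (A : Adinkra V N) (i : Fin N) : Even (Fintype.card V) :=
  SimpleGraph.Subgraph.IsPerfectMatching.even_card
    (M := SimpleGraph.toSubgraph (A.color.labelGraph i) A.color.labelGraph_le)
    (SimpleGraph.Subgraph.isPerfectMatching_iff.2 (A.existsUnique_labelGraph_adj i))

/-- The neighbor `A.neighbor i x` of the vertex `x` along its unique edge of color `i`. -/
noncomputable def neighbor (i : Fin N) (x : V) : V := (A.existsUnique_labelGraph_adj i x).choose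

theorem labelGraph_adj_iff {i : Fin N} {x y : V} :
    (A.color.labelGraph i).Adj x y ↔ y = A.neighbor i x := by
  have h := (A.existsUnique_labelGraph_adj i x).choose_spec
  exact ⟨h.2 y, fun hy => hy ▸ h.1⟩

theorem labelGraph_adj_neighbor (i : Fin N) (x : V) :
    (A.color.labelGraph i).Adj x (A.neighbor i x) :=
  A.labelGraph_adj_iff.2 rfl

theorem adj_neighbor (i : Fin N) (x : V) : A.graph.Adj x (A.neighbor i x) :=
  A.color.labelGraph_le (A.labelGraph_adj_neighbor i x)

theorem neighbor_neighbor (i : Fin N) (x : V) : A.neighbor i (A.neighbor i x) = x :=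
  (A.labelGraph_adj_iff.1 (A.labelGraph_adj_neighbor i x).symm).symm

theorem neighbor_injective (x : V) : Function.Injective fun i => A.neighbor i x := by
  intro i j hij
  by_contra hne
  exact SimpleGraph.disjoint_left.1 (SimpleGraph.EdgeLabeling.pairwise_disjoint_labelGraph hne)
    x _ (A.labelGraph_adj_neighbor i x) (A.labelGraph_adj_iff.2 hij)

theorem adj_iff_exists_neighbor {x y : V} : A.graph.Adj x y ↔ ∃ i, y = A.neighbor i x := by
  conv_lhs => rw [← A.color.iSup_labelGraph, SimpleGraph.iSup_adj]
  simp only [A.labelGraph_adj_iff]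

theorem neighbor_neighbor_ne {i j : Fin N} (h : i ≠ j) (x : V) :
    A.neighbor j (A.neighbor i x) ≠ x := fun heq =>
  h (A.neighbor_injective x (by simpa only [A.neighbor_neighbor] using congrArg (A.neighbor j) heq))

theorem bicolorGraph_le (i j : Fin N) : A.color.bicolorGraph i j ≤ A.graph :=
  sup_le A.color.labelGraph_le A.color.labelGraph_le

theorem bicolorGraph_adj_neighbor_left (i j : Fin N) (x : V) :
    (A.color.bicolorGraph i j).Adj x (A.neighbor i x) :=
  Or.inl (A.labelGraph_adj_neighbor i x)

theorem bicolorGraph_adj_neighbor_right (i j : Fin N) (x : V) :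
    (A.color.bicolorGraph i j).Adj x (A.neighbor j x) :=
  Or.inr (A.labelGraph_adj_neighbor j x)

theorem neighbor_comm {i j : Fin N} (h : i ≠ j) (x : V) :
    A.neighbor j (A.neighbor i x) = A.neighbor i (A.neighbor j x) := by
  have hi := A.bicolorGraph_adj_neighbor_left i j
  have hj := A.bicolorGraph_adj_neighbor_right i j
  let C := (A.color.bicolorGraph i j).connectedComponentMk x
  obtain ⟨φ⟩ := A.bicolor_component i j h C
  have hx : x ∈ C := rfl
  have hxi := C.mem_supp_of_adj_mem_supp hx (hi x)
  have hxj := C.mem_supp_of_adj_mem_supp hx (hj x)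
  have hxij := C.mem_supp_of_adj_mem_supp hxi (hj _)
  have hxji := C.mem_supp_of_adj_mem_supp hxj (hi _)
  have hne {y z : C} (hyz : y.1 ≠ z.1) : φ y ≠ φ z := φ.injective.ne fun heq => hyz (heq ▸ rfl)
  refine congrArg Subtype.val (φ.injective (cycleGraph_four_eq_of_adj (φ ⟨x, hx⟩) (φ ⟨_, hxi⟩)
    (φ ⟨_, hxj⟩) (φ ⟨_, hxij⟩) (φ ⟨_, hxji⟩) ?_ ?_ ?_ ?_ ?_ ?_ ?_))
  · exact φ.map_adj_iff.2 (hi x)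
  · exact φ.map_adj_iff.2 (hj x)
  · exact hne ((A.neighbor_injective x).ne h)
  · exact φ.map_adj_iff.2 (hj _)
  · exact hne (A.neighbor_neighbor_ne h x)
  · exact φ.map_adj_iff.2 (hi _)
  · exact hne (A.neighbor_neighbor_ne h.symm x)

theorem degree_eq [Fintype V] [DecidableRel A.graph.Adj] (x : V) : A.graph.degree x = N := by
  classical
  have hneighbors : A.graph.neighborFinset x = Finset.univ.image fun i => A.neighbor i x := by
    ext y
    simp [A.adj_iff_exists_neighbor, eq_comm]
  rw [← SimpleGraph.card_neighborFinset_eq_degree, hneighbors,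
    Finset.card_image_of_injective _ (A.neighbor_injective x), Finset.card_univ, Fintype.card_fin]

variable [DecidableRel A.graph.Adj]

theorem prod_signedAdjMatrix_square {i j : Fin N} (h : i ≠ j) (x : V) :
    A.signedAdjMatrix x (A.neighbor i x) *
      (A.signedAdjMatrix (A.neighbor i x) (A.neighbor j (A.neighbor i x)) *
        (A.signedAdjMatrix (A.neighbor j (A.neighbor i x)) (A.neighbor j x) *
          A.signedAdjMatrix (A.neighbor j x) x)) = -1 := by
  have hxa := A.bicolorGraph_adj_neighbor_left i j x
  have hac := A.bicolorGraph_adj_neighbor_right i j (A.neighbor i x)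
  have hbx := (A.bicolorGraph_adj_neighbor_right i j x).symm
  have hcb := (A.bicolorGraph_adj_neighbor_left i j (A.neighbor j x)).symm
  have hab := (A.neighbor_injective x).ne h
  have hcx := A.neighbor_neighbor_ne h x
  rw [← A.neighbor_comm h] at hcb
  let p := SimpleGraph.Walk.cons hxa (.cons hac (.cons hcb (.cons hbx .nil)))
  have hcycle : p.IsCycle := by
    have := hxa.ne
    have := hac.ne
    have := hcb.ne
    have := hbx.ne
    rw [SimpleGraph.Walk.isCycle_iff_isPath_tail_and_le_length]
    simp only [p, SimpleGraph.Walk.isPath_def, SimpleGraph.Walk.getVert_cons_succ,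
      SimpleGraph.Walk.tail_cons, SimpleGraph.Walk.support_copy, SimpleGraph.Walk.support_cons,
      SimpleGraph.Walk.support_nil, List.nodup_cons, List.mem_cons, List.not_mem_nil,
      List.nodup_nil, SimpleGraph.Walk.length_cons, SimpleGraph.Walk.length_nil]
    grind
  have hprod := A.prod_darts_signedAdjMatrix (A.bicolorGraph_le i j) hcycle.isTrail
  rw [(A.odd_negative i j h x p hcycle rfl).neg_one_pow] at hprod
  simpa [p] using hprod

theorem signedAdjMatrix_mul_neighbor {i j : Fin N} (h : i ≠ j) (x : V) :
    A.signedAdjMatrix x (A.neighbor i x) *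
      A.signedAdjMatrix (A.neighbor i x) (A.neighbor j (A.neighbor i x)) =
    -(A.signedAdjMatrix x (A.neighbor j x) *
      A.signedAdjMatrix (A.neighbor j x) (A.neighbor i (A.neighbor j x))) := by
  have hsquare := A.prod_signedAdjMatrix_square h x
  have hxb := A.signedAdjMatrix_mul_self_of_adj (A.adj_neighbor j x)
  have hbc := A.signedAdjMatrix_mul_self_of_adj (A.adj_neighbor i (A.neighbor j x))
  rw [A.neighbor_comm h, A.signedAdjMatrix_comm _ (A.neighbor j x),
    A.signedAdjMatrix_comm _ x] at hsquare
  rw [A.neighbor_comm h]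
  linear_combination
    A.signedAdjMatrix (A.neighbor j x) (A.neighbor i (A.neighbor j x)) *
      A.signedAdjMatrix x (A.neighbor j x) * hsquare -
    A.signedAdjMatrix x (A.neighbor i x) *
      A.signedAdjMatrix (A.neighbor i x) (A.neighbor i (A.neighbor j x)) *
      (A.signedAdjMatrix x (A.neighbor j x) ^ 2 * hbc + hxb)

variable [DecidableEq V]

/-- The part of the signed adjacency matrix supported on the edges of color `i`. -/
noncomputable def colorMatrix (i : Fin N) : Matrix V V ℤ :=
  Matrix.of fun x y => if y = A.neighbor i x then A.signedAdjMatrix x y else 0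

theorem sum_colorMatrix : ∑ i, A.colorMatrix i = A.signedAdjMatrix := by
  ext x y
  simp only [Matrix.sum_apply, colorMatrix, Matrix.of_apply]
  by_cases h : A.graph.Adj x y
  · obtain ⟨i, rfl⟩ := A.adj_iff_exists_neighbor.1 h
    simp [(A.neighbor_injective x).eq_iff]
  · simp [A.signedAdjMatrix_of_not_adj h]

variable [Fintype V]

theorem colorMatrix_mul_apply (i j : Fin N) (x z : V) :
    (A.colorMatrix i * A.colorMatrix j) x z = if z = A.neighbor j (A.neighbor i x) then
      A.signedAdjMatrix x (A.neighbor i x) * A.signedAdjMatrix (A.neighbor i x) z else 0 := by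
  rw [Matrix.mul_apply, Finset.sum_eq_single (A.neighbor i x) (fun y _ hy => ?_) (by simp)]
  · simp [colorMatrix]
  · simp [colorMatrix, hy]

theorem colorMatrix_mul_self (i : Fin N) : A.colorMatrix i * A.colorMatrix i = 1 := by
  ext x z
  rw [colorMatrix_mul_apply, neighbor_neighbor]
  obtain rfl | h := eq_or_ne z x
  · rw [if_pos rfl, A.signedAdjMatrix_comm (A.neighbor i z) z,
      A.signedAdjMatrix_mul_self_of_adj (A.adj_neighbor i z), Matrix.one_apply_eq]
  · rw [if_neg h, Matrix.one_apply_ne h.symm]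

theorem colorMatrix_mul_add_mul {i j : Fin N} (h : i ≠ j) :
    A.colorMatrix i * A.colorMatrix j + A.colorMatrix j * A.colorMatrix i = 0 := by
  ext x z
  rw [Matrix.add_apply, colorMatrix_mul_apply, colorMatrix_mul_apply, A.neighbor_comm h]
  split_ifs with hz
  · rw [hz]
    have hsigns := A.signedAdjMatrix_mul_neighbor h x
    rw [A.neighbor_comm h] at hsigns
    rw [hsigns, neg_add_cancel, Matrix.zero_apply]
  · simp

theorem colorMatrix_mul_signedAdjMatrix_add (i : Fin N) :
    A.colorMatrix i * A.signedAdjMatrix + A.signedAdjMatrix * A.colorMatrix i = 2 := by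
  rw [← A.sum_colorMatrix, Finset.mul_sum, Finset.sum_mul, ← Finset.sum_add_distrib,
    Finset.sum_eq_single i (fun j _ hj => A.colorMatrix_mul_add_mul hj.symm) (by simp),
    A.colorMatrix_mul_self, one_add_one_eq_two]

theorem signedAdjMatrix_mul_self : A.signedAdjMatrix * A.signedAdjMatrix = N := by
  have htwice : (2 : ℤ) • (A.signedAdjMatrix * A.signedAdjMatrix) =
      (2 : ℤ) • (N : Matrix V V ℤ) := by
    calc (2 : ℤ) • (A.signedAdjMatrix * A.signedAdjMatrix)
        = ∑ i, (A.colorMatrix i * A.signedAdjMatrix + A.signedAdjMatrix * A.colorMatrix i) := by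
          rw [Finset.sum_add_distrib, ← Finset.sum_mul, ← Finset.mul_sum, A.sum_colorMatrix,
            two_smul]
      _ = (2 : ℤ) • (N : Matrix V V ℤ) := by
          simp only [A.colorMatrix_mul_signedAdjMatrix_add, Finset.sum_const, Finset.card_univ,
            Fintype.card_fin, nsmul_eq_mul, two_smul, mul_two]
  exact smul_right_injective _ two_ne_zero htwice

theorem laplacian_eq : A.laplacian = N - A.signedAdjMatrix := by
  rw [SignedGraph.laplacian, SimpleGraph.degMatrix, ← Matrix.diagonal_natCast]
  simp only [A.degree_eq]

theorem laplacian_mul :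
    A.laplacian * (N + A.signedAdjMatrix) = ((N ^ 2 - N : ℕ) : Matrix V V ℤ) := by
  rw [A.laplacian_eq, ← (Nat.cast_commute N A.signedAdjMatrix).mul_self_sub_mul_self_eq',
    A.signedAdjMatrix_mul_self, ← sq, Nat.cast_sub (Nat.le_self_pow two_ne_zero N), Nat.cast_pow]

theorem colorMatrix_mul_laplacian_add (i : Fin N) :
    -A.colorMatrix i * A.laplacian + (N + A.signedAdjMatrix) * A.colorMatrix i = 2 := by
  rw [A.laplacian_eq, ← A.colorMatrix_mul_signedAdjMatrix_add i, mul_sub, add_mul,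
    (Nat.cast_commute N (A.colorMatrix i)).eq]
  noncomm_ring

theorem isConj_laplacian : IsConj A.laplacian (N + A.signedAdjMatrix) := by
  obtain ⟨J, hJ⟩ := A.exists_semiconjBy_signedAdjMatrix_neg A.bipartite
  refine ⟨J, ?_⟩
  rw [A.laplacian_eq, ← sub_neg_eq_add]
  exact SemiconjBy.sub_right (Nat.commute_cast J.val N) hJ

end Adinkra

theorem theorem1p2 {V : Type*} [Fintype V] [DecidableEq V] {N : ℕ} (hN : 2 ≤ N)
    (A : Adinkra V N) [DecidableRel A.graph.Adj] :
    Even (Fintype.card V) ∧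
    A.graph.laplacianTwoRank ≤ Fintype.card V / 2 ∧
    ∀ m : ℕ, A.graph.laplacianTwoRank + m = Fintype.card V / 2 →
      Nonempty (A.toSignedGraph.CriticalGroup ≃+
        (Fin m → ZMod 2) × (Fin m → ZMod ((N ^ 2 - N) / 2)) ×
          (Fin (Fintype.card V / 2 - m) → ZMod (N ^ 2 - N))) := by
  let i : Fin N := ⟨0, by omega⟩
  have heven := A.even_card i
  have hcard := (Nat.two_mul_div_two_of_even heven).symm
  have hM : N ^ 2 - N ≠ 0 := Nat.sub_ne_zero_of_lt (lt_self_pow₀ hN one_lt_two)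
  have hM2 : 2 ∣ N ^ 2 - N := by
    rw [sq, ← Nat.mul_sub_one]
    exact (Nat.even_mul_pred_self N).two_dvd
  have hrank : (A.laplacian.map (Int.castRingHom (ZMod 2))).rank = A.graph.laplacianTwoRank := by
    rw [A.laplacian_map_zmod_two, SimpleGraph.laplacianTwoRank]
  refine ⟨heven, ?_, fun m hm => ?_⟩
  · exact hrank ▸ rank_map_zmod_le hM2 hcard A.laplacian_mul A.isConj_laplacian
  · obtain ⟨φ⟩ := nonempty_coker_addEquiv (m := m) (r := Fintype.card V / 2 - m) hM hM2
      (by omega) A.laplacian_mul (A.colorMatrix_mul_laplacian_add i) A.isConj_laplacian (by omega)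
    have htorsion := torsion_coker_eq_top (R := ℤ)
      (mem_nonZeroDivisors_of_ne_zero (Nat.cast_ne_zero.2 hM)) A.laplacian_mul
    exact ⟨((LinearEquiv.ofEq _ _ htorsion).trans Submodule.topEquiv).toAddEquiv.trans φ⟩
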